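/- Let $L$ be a relational language and let $\mathbf K$ be a countably infinite ultrahomogeneous $L$-structure (that is, a Fraïssé structure): every isomorphism between finite substructures of $\mathbf K$ extends to an automorphism of $\mathbf K$. Let $G=\mathrm{Aut}(\mathbf K)$ and fix an exhaustion $\mathbf K=\bigcup_n \mathbf A_n$ by finite substructures with $\mathbf A_m\subseteq \mathbf A_n$ for $m\le n$. Let $H_n=\mathrm{Emb}(\mathbf A_n,\mathbf K)$ be the set of embeddings of $\mathbf A_n$ into $\mathbf K$, with the left action $g\cdot x=g\circ x$ of $G$, and let $\beta H_n$ be the space of ultrafilters on $H_n$, with basic clopen sets $\overline T=\{p\in\beta H_n: T\in p\}$, $T\subseteq H_n$. For $m\le n$ let $\tilde\imath^n_m:\beta H_n\to\beta H_m$ be the push-forward of ultrafilters along the restriction map $x\mapsto x|_{\mathbf A_m}$. The Samuel compactification of $G$ is $S(G)=\varprojlim\beta H_n$, the inverse limit along these maps; write $\alpha(m)\in\beta H_m$ for the $m$-th coordinate of $\alpha\in S(G)$. For $\alpha\in S(G)$ and $f\in H_m$ let $\alpha\cdot f\in\beta H_m$ be the ultrafilter with $$S\in\alpha\cdot f\iff\{x\in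 H_n: x\circ f\in S\}\in\alpha(n)\qquad(S\subseteq H_m),$$ where $n\ge m$ is any index with $\mathrm{ran}(f)\subseteq\mathbf A_n$. Then $S(G)$ is a semigroup under $$S\in(\alpha\gamma)(m)\iff\{f\in H_m: S\in\alpha\cdot f\}\in\gamma(m)\qquad(S\subseteq H_m).$$ A right ideal is a non-empty $I\subseteq S(G)$ with $I\cdot S(G)\subseteq I$; it is minimal if it contains no right ideal other than itself. A set $T\subseteq H_m$ is thick if $\chi_{H_m}\in\overline{\{\chi_T\cdot g: g\in G\}}$ in $2^{H_m}$ with the product topology, where $(\chi\cdot g)(f)=\chi(g\circ f)$. Let $\mathcal T_m$ be the family of thick subsets of $H_m$. A $\mathcal T_m$-filter is a filter $F$ on $H_m$ with $F\subseteq\mathcal T_m$, and $\beta(\mathcal T_m)$ denotes the set of maximal $\mathcal T_m$-filters. **Theorem.** Let $Y=\varprojlim Y_n\subseteq S(G)$ be compact, where $Y_m\subseteq\beta H_m$ is closed for each $m$ and $\tilde\imath^n_m(Y_n)=Y_m$ for all $m\le n$. For each $m$ let $F_m=\{T\subseteq H_m: Y_m\subseteq\overline T\}$ be the filter of clopen neighborhoods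 of $Y_m$, i.e. the unique filter with $Y_m=\bigcap_{T\in F_m}\overline T$. Then $Y$ is a minimal right ideal of $S(G)$ if and only if $F_m\in\beta(\mathcal T_m)$ for every $m$. -/

import Mathlib

open scoped FirstOrder

universe u v w

/-! ### Families and their ultrafilters -/

/-- For a family `S` of subsets of `X`, an `S`-filter is a filter on `X` contained in `S`. -/
def IsFamilyFilter {X : Type*} (S : Set (Set X)) (F : Filter X) : Prop :=
  F.sets ⊆ S

/-- `familyBeta S` is the collection of maximal (for inclusion of filters, as sets of subsets
of `X`) `S`-filters, that is, of `S`-ultrafilters. -/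
def familyBeta {X : Type*} (S : Set (Set X)) : Set (Filter X) :=
  {F | IsFamilyFilter S F ∧
    ∀ F' : Filter X, IsFamilyFilter S F' → F.sets ⊆ F'.sets → F'.sets ⊆ F.sets}

/-! ### Clopen neighborhoods of closed sets of ultrafilters -/

/-- The clopen subset of `βX` of all ultrafilters that contain `T`. -/
def clopenOf {X : Type*} (T : Set X) : Set (Ultrafilter X) :=
  {p | T ∈ p}

/-- The filter on `X` of clopen neighborhoods of `Y ⊆ βX`: it consists of the sets `T ⊆ X` such
that the clopen set of `T` contains `Y`. -/
def clopenNhdsFilter {X : Type*} (Y : Set (Ultrafilter X)) : Filter X where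
  sets := {T | Y ⊆ clopenOf T}
  univ_sets := fun _ _ => Filter.univ_mem
  sets_of_superset := fun h hs _ hp => Filter.mem_of_superset (h hp) hs
  inter_sets := fun h h' _ hp => Filter.inter_mem (h hp) (h' hp)

/-- For closed `Y`, the filter of clopen neighborhoods of `Y` is the one and only filter `F`
with `Y = ⋂ T ∈ F, clopenOf T`. -/
theorem eq_iInter_clopenOf_iff {X : Type*} {Y : Set (Ultrafilter X)} (hY : IsClosed Y)
    (F : Filter X) : Y = ⋂ T ∈ F, clopenOf T ↔ F = clopenNhdsFilter Y := by
  have key : ∀ F : Filter X, ∀ T : Set X, (⋂ U ∈ F, clopenOf U) ⊆ clopenOf T → T ∈ F := by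
    intro F T h
    rw [Filter.mem_iff_ultrafilter]
    intro p hp
    refine h ?_
    simp only [Set.mem_iInter]
    exact fun U hU => hp hU
  constructor
  · intro h
    ext T
    constructor
    · intro hT p hp
      rw [h] at hp
      simp only [Set.mem_iInter] at hp
      exact hp T hT
    · intro hT
      have hT' : Y ⊆ clopenOf T := hT
      rw [h] at hT'
      exact key F T hT'
  · rintro rfl
    apply Set.Subset.antisymm
    · intro p hp
      simp only [Set.mem_iInter]
      exact fun T hT => hT hp
    · intro p hp
      by_contra hpY
      obtain ⟨t, ⟨s, rfl⟩, hps, hsub⟩ :=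
        ultrafilterBasis_is_basis.mem_nhds_iff.1 (hY.isOpen_compl.mem_nhds hpY)
      simp only [Set.mem_iInter] at hp
      have hc : sᶜ ∈ clopenNhdsFilter Y := by
        intro q hq
        refine Ultrafilter.compl_mem_iff_notMem.2 fun hqs => ?_
        exact hsub hqs hq
      exact Ultrafilter.compl_mem_iff_notMem.1 (hp _ hc) hps

/-! ### Right ideals -/

/-- A right ideal of a semigroup: a non-empty subset `I` with `I S ⊆ I`. -/
def IsRightIdeal {S : Type*} [Semigroup S] (I : Set S) : Prop :=
  I.Nonempty ∧ ∀ a ∈ I, ∀ s : S, a * s ∈ I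

/-- A minimal right ideal: a right ideal that contains no other right ideal. -/
def IsMinimalRightIdeal {S : Type*} [Semigroup S] (I : Set S) : Prop :=
  IsRightIdeal I ∧ ∀ J : Set S, IsRightIdeal J → J ⊆ I → J = I

/-! ### The Samuel compactification of the automorphism group -/

/-- An exhaustion of the structure `K` by an increasing sequence of finite substructures. -/
structure FiniteExhaustion (L : FirstOrder.Language.{u, v}) (K : Type w) [L.Structure K] where
  /-- the `n`-th finite substructure -/
  sub : ℕ → L.Substructure K
  finite_sub : ∀ n, (sub n : Set K).Finite
  mono_sub : Monotone sub
  exhausts : ∀ x : K, ∃ n, x ∈ sub n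

namespace FiniteExhaustion

variable {L : FirstOrder.Language.{u, v}} {K : Type w} [L.Structure K] (A : FiniteExhaustion L K)

/-- `A.H n` is the set of embeddings of `A n` into `K`. -/
abbrev H (n : ℕ) : Type w := A.sub n ↪[L] K

/-- The inclusion of `A m` into `A n`, for `m ≤ n`. -/
def incl {m n : ℕ} (h : m ≤ n) : A.sub m ↪[L] A.sub n :=
  FirstOrder.Language.Substructure.inclusion (A.mono_sub h)

/-- The dual map `H n → H m`, `x ↦ x ∘ f`, of an embedding `f : A m → A n`. -/
def dual {m n : ℕ} (f : A.sub m ↪[L] A.sub n) : A.H n → A.H m :=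
  fun x => x.comp f

/-- The continuous extension `β H n → β H m` of the dual map of `f`. -/
def dualBeta {m n : ℕ} (f : A.sub m ↪[L] A.sub n) : Ultrafilter (A.H n) → Ultrafilter (A.H m) :=
  Ultrafilter.map (A.dual f)

/-- The Samuel compactification `S(G)` of `G = Aut(K)`, constructed as the inverse limit of the
spaces `β H n` along the extended restriction maps. -/
def Samuel : Type w :=
  {α : ∀ n, Ultrafilter (A.H n) // ∀ (m n : ℕ) (h : m ≤ n), A.dualBeta (A.incl h) (α n) = α m}

/-- The topology of the inverse limit: a subspace of the product of the spaces `β H n`. -/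
instance : TopologicalSpace A.Samuel :=
  inferInstanceAs (TopologicalSpace
    {α : ∀ n, Ultrafilter (A.H n) //
      ∀ (m n : ℕ) (h : m ≤ n), A.dualBeta (A.incl h) (α n) = α m})

variable {A}

/-- The `m`-th coordinate `α(m)`. -/
def Samuel.coord (α : A.Samuel) (m : ℕ) : Ultrafilter (A.H m) := α.1 m

theorem Samuel.ext_coord {α γ : A.Samuel} (h : ∀ m, α.coord m = γ.coord m) : α = γ :=
  Subtype.ext (funext h)

/-- Every embedding of `A m` into `K` has range in some `A n` with `n ≥ m`. -/
theorem exists_factor {m : ℕ} (f : A.H m) :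
    ∃ n, ∃ f' : A.sub m ↪[L] A.sub n, m ≤ n ∧ (A.sub n).subtype.comp f' = f := by
  classical
  choose k hk using fun x : A.sub m => A.exhausts (f x)
  have : Finite (A.sub m) := (A.finite_sub m).to_subtype
  obtain ⟨N, hN⟩ := (Set.finite_range k).bddAbove
  refine ⟨max m N, f.codRestrict _ fun x => ?_, le_max_left _ _, ?_⟩
  · exact A.mono_sub ((hN ⟨x, rfl⟩).trans (le_max_right _ _)) (hk x)
  · exact FirstOrder.Language.Embedding.subtype_comp_codRestrict _ _ _

/-- `α · f` for `α ∈ S(G)` and `f ∈ H m`: choose `n ≥ m` with `ran f ⊆ A n`, so that `f` is an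
embedding `f'` of `A m` into `A n`; then a set `S` belongs to `α · f` iff
`{x ∈ H n | x ∘ f' ∈ S}` belongs to `α(n)`. -/
noncomputable def Samuel.act (α : A.Samuel) {m : ℕ} (f : A.H m) : Ultrafilter (A.H m) :=
  A.dualBeta (exists_factor f).choose_spec.choose (α.coord (exists_factor f).choose)

/-- `α · f` does not depend on the choice of `n`. -/
theorem Samuel.act_eq (α : A.Samuel) {m n : ℕ} (f : A.H m) (f' : A.sub m ↪[L] A.sub n)
    (hf : (A.sub n).subtype.comp f' = f) : α.act f = A.dualBeta f' (α.coord n) := by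
  have aux : ∀ (a b : ℕ) (g : A.sub m ↪[L] A.sub a) (h : A.sub m ↪[L] A.sub b), a ≤ b →
      (A.sub a).subtype.comp g = (A.sub b).subtype.comp h →
      A.dualBeta g (α.coord a) = A.dualBeta h (α.coord b) := by
    intro a b g h hab hgh
    have hh : h = (A.incl hab).comp g := by
      ext x
      exact (DFunLike.congr_fun hgh x).symm
    have hc : α.coord a = A.dualBeta (A.incl hab) (α.coord b) := (α.2 a b hab).symm
    rw [hc, hh]
    rfl
  have h0 := (exists_factor f).choose_spec.choose_spec.2
  rcases le_total (exists_factor f).choose n with h | h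
  · exact aux _ _ _ _ h (h0.trans hf.symm)
  · exact (aux _ _ _ _ h (hf.trans h0.symm)).symm

theorem Samuel.mem_act (α : A.Samuel) {m n : ℕ} (f : A.H m) (f' : A.sub m ↪[L] A.sub n)
    (hf : (A.sub n).subtype.comp f' = f) (S : Set (A.H m)) :
    S ∈ α.act f ↔ {x : A.H n | x.comp f' ∈ S} ∈ α.coord n := by
  rw [α.act_eq f f' hf]
  rfl

theorem Samuel.act_dual (α : A.Samuel) {m n : ℕ} (g : A.sub m ↪[L] A.sub n) (f : A.H n) :
    α.act (A.dual g f) = A.dualBeta g (α.act f) := by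
  obtain ⟨N, f', -, hf⟩ := exists_factor f
  rw [α.act_eq f f' hf, α.act_eq (A.dual g f) (f'.comp g) (by rw [← hf]; rfl)]
  rfl

/-- The product `αγ` on `S(G)`: a set `S ⊆ H m` belongs to `αγ(m)` iff
`{f ∈ H m | S ∈ α · f}` belongs to `γ(m)`. -/
noncomputable def Samuel.mul (α γ : A.Samuel) : A.Samuel :=
  ⟨fun m => (γ.coord m).bind fun f => α.act f, by
    intro m n h
    have hc : γ.coord m = A.dualBeta (A.incl h) (γ.coord n) := (γ.2 m n h).symm
    change A.dualBeta (A.incl h) ((γ.coord n).bind fun f => α.act f) =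
      (γ.coord m).bind fun f => α.act f
    rw [hc]
    ext S
    change {f | A.dual (A.incl h) ⁻¹' S ∈ α.act f} ∈ γ.coord n ↔
      {f | S ∈ α.act (A.dual (A.incl h) f)} ∈ γ.coord n
    simp only [Samuel.act_dual]
    rfl⟩

theorem Samuel.mem_mul (α γ : A.Samuel) (m : ℕ) (S : Set (A.H m)) :
    S ∈ (α.mul γ).coord m ↔ {f : A.H m | S ∈ α.act f} ∈ γ.coord m :=
  Iff.rfl

theorem Samuel.act_mul (α γ : A.Samuel) {m : ℕ} (f : A.H m) (S : Set (A.H m)) :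
    S ∈ (α.mul γ).act f ↔ {h : A.H m | S ∈ α.act h} ∈ γ.act f := by
  obtain ⟨n, f', -, hf⟩ := exists_factor f
  rw [Samuel.mem_act _ f f' hf, Samuel.mem_act _ f f' hf, Samuel.mem_mul]
  change {h : A.H n | A.dual f' ⁻¹' S ∈ α.act h} ∈ γ.coord n ↔
    {h : A.H n | S ∈ α.act (A.dual f' h)} ∈ γ.coord n
  simp only [Samuel.act_dual]
  rfl

noncomputable instance : Semigroup A.Samuel where
  mul := Samuel.mul
  mul_assoc := by
    intro α γ δ
    refine Samuel.ext_coord fun m => ?_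
    ext S
    change {f : A.H m | S ∈ (α.mul γ).act f} ∈ δ.coord m ↔
      {f : A.H m | {h : A.H m | S ∈ α.act h} ∈ γ.act f} ∈ δ.coord m
    simp only [Samuel.act_mul]

variable (A)

/-! ### Thick sets -/

/-- The characteristic function of `T ⊆ H m`, a point of `2 ^ H m`. -/
noncomputable def chi {m : ℕ} (T : Set (A.H m)) : A.H m → Bool :=
  open Classical in fun f => decide (f ∈ T)

/-- The right shift action of `G = Aut(K)` on `2 ^ H m`: `(χ · g)(f) = χ(g ∘ f)`. -/
def shift {m : ℕ} (χ : A.H m → Bool) (g : K ≃[L] K) : A.H m → Bool :=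
  fun f => χ (g.toEmbedding.comp f)

/-- `T ⊆ H m` is thick if the characteristic function of `H m` is in the closure of the orbit
of the characteristic function of `T`, for the product topology of `2 ^ H m`. -/
def IsThick {m : ℕ} (T : Set (A.H m)) : Prop :=
  A.chi (Set.univ : Set (A.H m)) ∈ closure (Set.range fun g : K ≃[L] K => A.shift (A.chi T) g)

/-- The family of thick subsets of `H m`. -/
def thickFamily (m : ℕ) : Set (Set (A.H m)) :=
  {T | A.IsThick T}

end FiniteExhaustion

open FirstOrder Filter

namespace FiniteExhaustion

variable {L : FirstOrder.Language.{u, v}} {K : Type w} [L.Structure K] {A : FiniteExhaustion L K}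

/-! ### Topology of the Samuel compactification -/

/-! A filter `F` on `H m` consists of thick sets iff one `α` satisfies `F ⊆ α · f` for all `f`
(`isThick_of_forall_mem_act`, `exists_forall_mem_act`). By ultrahomogeneity each `α · f` is the
`m`-th coordinate of a member of `α S(G)`, so this says that the closed set of `F` contains the
projection of `α S(G)`. Maximal thick filters thus correspond to minimal closed sets containing the
projection of some `α S(G)`.

If `Y` is minimal, it has a left identity `u`. For a thick `F ⊇ F_m` with its `α`, minimality gives
`u α S(G) = Y`, while `u` fixes the `m`-th coordinates of `α S(G)` since they lie in `Y_m`; so `Y_m`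
lies in the closed set of `F`.

Conversely, compactness yields one `α` with `α S(G)` lying over every `Y_m`. Maximality makes each
projection all of `Y_m`, so `α S(G) = Y`; the same argument gives `β S(G) = Y` for every `β ∈ Y`. -/

theorem continuous_ultrafilter_map {X Z : Type*} (f : X → Z) :
    Continuous (Ultrafilter.map f : Ultrafilter X → Ultrafilter Z) := by
  refine ultrafilterBasis_is_basis.continuous_iff.2 ?_
  rintro _ ⟨T, rfl⟩
  exact ultrafilter_isOpen_basic (f ⁻¹' T)

theorem Samuel.continuous_coord (m : ℕ) : Continuous fun α : A.Samuel => α.coord m :=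
  (continuous_apply m).comp continuous_subtype_val

theorem Samuel.coord_of_le (α : A.Samuel) {m n : ℕ} (h : m ≤ n) :
    A.dualBeta (A.incl h) (α.coord n) = α.coord m :=
  α.2 m n h

instance : T2Space A.Samuel :=
  inferInstanceAs (T2Space {α : ∀ n, Ultrafilter (A.H n) //
      ∀ (m n : ℕ) (h : m ≤ n), A.dualBeta (A.incl h) (α n) = α m})

instance : CompactSpace A.Samuel := by
  refine isCompact_iff_compactSpace.1 (IsClosed.isCompact (X := ∀ n, Ultrafilter (A.H n))
    (s := {α | ∀ (m n : ℕ) (h : m ≤ n), A.dualBeta (A.incl h) (α n) = α m}) ?_)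
  simp only [Set.ofPred_forall]
  refine isClosed_iInter fun m => isClosed_iInter fun n => isClosed_iInter fun h => ?_
  exact isClosed_eq ((continuous_ultrafilter_map _).comp (continuous_apply n))
    (continuous_apply m)

theorem Samuel.continuous_mul_left (α : A.Samuel) : Continuous fun γ : A.Samuel => α * γ := by
  refine Continuous.subtype_mk (continuous_pi fun m => ?_) _
  refine ultrafilterBasis_is_basis.continuous_iff.2 ?_
  rintro _ ⟨T, rfl⟩
  exact (ultrafilter_isOpen_basic {f : A.H m | T ∈ α.act f}).preimage (Samuel.continuous_coord m)

theorem Samuel.continuous_act {m : ℕ} (f : A.H m) :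
    Continuous fun α : A.Samuel => α.act f := by
  obtain ⟨n, f', -, hf⟩ := exists_factor f
  simp only [fun α : A.Samuel => α.act_eq f f' hf]
  exact (continuous_ultrafilter_map _).comp (Samuel.continuous_coord n)

/-- The witness `z` may vary with `m`; coherence makes the closed sets of witnesses decrease, and
compactness gives a common one. -/
theorem Samuel.mem_of_coord {Z : Set A.Samuel} (hZ : IsCompact Z) (α : A.Samuel)
    (h : ∀ m, ∃ z ∈ Z, z.coord m = α.coord m) : α ∈ Z := by
  have hc : ∀ m, IsClosed (Z ∩ {z : A.Samuel | z.coord m = α.coord m}) := fun m =>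
    hZ.isClosed.inter (isClosed_eq (Samuel.continuous_coord m) continuous_const)
  obtain ⟨z, hz⟩ := IsCompact.nonempty_iInter_of_sequence_nonempty_isCompact_isClosed
    (fun m => Z ∩ {z : A.Samuel | z.coord m = α.coord m})
    (fun m z hz => ⟨hz.1, by
      have h1 : z.coord (m + 1) = α.coord (m + 1) := hz.2
      change z.coord m = α.coord m
      rw [← z.coord_of_le m.le_succ, ← α.coord_of_le m.le_succ]
      exact congrArg _ h1⟩)
    (fun m => (h m).imp fun z hz => hz) (hc 0).isCompact hc
  rw [Set.mem_iInter] at hz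
  rw [← Samuel.ext_coord fun m => (hz m).2]
  exact (hz 0).1

/-! ### Ultrafilters on the automorphism group -/

variable (A) in
/-- The restriction of an automorphism of `K` to `A n`. -/
def restrict (n : ℕ) (g : K ≃[L] K) : A.H n :=
  g.toEmbedding.comp (A.sub n).subtype

variable (A) in
/-- The canonical map `β G → S(G)`. -/
def ofUltrafilter (U : Ultrafilter (K ≃[L] K)) : A.Samuel :=
  ⟨fun n => U.map (A.restrict n), fun _ _ _ => rfl⟩

theorem coord_ofUltrafilter (U : Ultrafilter (K ≃[L] K)) (m : ℕ) :
    (A.ofUltrafilter U).coord m = U.map (A.restrict m) :=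
  rfl

theorem mem_act_ofUltrafilter (U : Ultrafilter (K ≃[L] K)) {m : ℕ} (f : A.H m)
    (T : Set (A.H m)) :
    T ∈ (A.ofUltrafilter U).act f ↔ {g : K ≃[L] K | g.toEmbedding.comp f ∈ T} ∈ U := by
  obtain ⟨n, f', -, rfl⟩ := exists_factor f
  rw [Samuel.mem_act _ _ f' rfl]
  rfl

/-- Shows that `(αγ)(m)` depends on `γ` only through `γ(m)`. -/
theorem Samuel.coord_mul (α γ : A.Samuel) (m : ℕ) :
    (α * γ).coord m = (γ.coord m).bind fun f => α.act f :=
  rfl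

theorem Samuel.coord_mul_pure (α : A.Samuel) (g : K ≃[L] K) (m : ℕ) :
    (α * A.ofUltrafilter (pure g)).coord m = α.act (A.restrict m g) :=
  rfl

theorem exists_restrict_eq (hK : L.IsUltrahomogeneous K) {m : ℕ} (f : A.H m) :
    ∃ g : K ≃[L] K, A.restrict m g = f := by
  obtain ⟨g, hg⟩ := hK (A.sub m)
    (FirstOrder.Language.Substructure.fg_def.2
      ⟨A.sub m, A.finite_sub m, FirstOrder.Language.Substructure.closure_eq _⟩) f
  exact ⟨g, hg.symm⟩

theorem Samuel.exists_coord_eq (hK : L.IsUltrahomogeneous K) {m : ℕ}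
    (p : Ultrafilter (A.H m)) : ∃ α : A.Samuel, α.coord m = p := by
  choose σ hσ using fun f : A.H m => exists_restrict_eq hK f
  refine ⟨A.ofUltrafilter (p.map σ), ?_⟩
  rw [coord_ofUltrafilter, Ultrafilter.map_map, show A.restrict m ∘ σ = id from funext hσ,
    Ultrafilter.map_id]

/-- A coherent sequence of closed sets with surjective bonding maps is the sequence of
projections of its inverse limit. -/
theorem Samuel.exists_mem_limit_coord_eq (hK : L.IsUltrahomogeneous K)
    {Yn : ∀ m, Set (Ultrafilter (A.H m))} (hclosed : ∀ m, IsClosed (Yn m))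
    (hsurj : ∀ (m n : ℕ) (h : m ≤ n), A.dualBeta (A.incl h) '' Yn n = Yn m)
    {m : ℕ} {p : Ultrafilter (A.H m)} (hp : p ∈ Yn m) :
    ∃ α : A.Samuel, (∀ n, α.coord n ∈ Yn n) ∧ α.coord m = p := by
  have hdown : ∀ (α : A.Samuel) {k n : ℕ}, k ≤ n → α.coord n ∈ Yn n → α.coord k ∈ Yn k := by
    intro α k n h hα
    rw [← hsurj k n h]
    exact ⟨_, hα, α.coord_of_le h⟩
  -- Indices start at `m`, so that the condition at level `m + n` can be met by lifting `p` along
  -- the surjection.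
  have hc : ∀ n, IsClosed {α : A.Samuel | α.coord (m + n) ∈ Yn (m + n) ∧ α.coord m = p} :=
    fun n => ((hclosed _).preimage (Samuel.continuous_coord _)).inter
      (isClosed_eq (Samuel.continuous_coord m) continuous_const)
  obtain ⟨α, hα⟩ := IsCompact.nonempty_iInter_of_sequence_nonempty_isCompact_isClosed
    (fun n => {α : A.Samuel | α.coord (m + n) ∈ Yn (m + n) ∧ α.coord m = p})
    (fun n α h => ⟨hdown α (by omega) h.1, h.2⟩)
    (fun n => by
      have hp' := hp
      rw [← hsurj m (m + n) (by omega)] at hp'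
      obtain ⟨q, hq, hqp⟩ := hp'
      obtain ⟨α, rfl⟩ := Samuel.exists_coord_eq hK q
      exact ⟨α, hq, (α.coord_of_le _).symm.trans hqp⟩)
    (hc 0).isCompact hc
  rw [Set.mem_iInter] at hα
  exact ⟨α, fun n => hdown α (by omega) (hα n).1, (hα 0).2⟩

/-! ### Thick sets and right ideals -/

theorem isThick_iff {m : ℕ} {T : Set (A.H m)} :
    A.IsThick T ↔ ∀ E : Finset (A.H m), ∃ g : K ≃[L] K, ∀ f ∈ E, g.toEmbedding.comp f ∈ T := by
  classical
  have hb : ∀ (χ : A.H m → Bool) (E : Finset (A.H m)),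
      {ψ : A.H m → Bool | ∀ f ∈ E, ψ f = χ f} ∈ nhds χ := by
    intro χ E
    have : {ψ : A.H m → Bool | ∀ f ∈ E, ψ f = χ f} = (E : Set (A.H m)).pi fun f => {χ f} := by
      ext ψ
      simp [Set.mem_pi]
    rw [this]
    exact set_pi_mem_nhds E.finite_toSet fun f _ => by simp
  unfold IsThick
  rw [mem_closure_iff_nhds]
  constructor
  · intro h E
    obtain ⟨_, hψ, g, rfl⟩ := h _ (hb _ E)
    refine ⟨g, fun f hf => ?_⟩
    simpa [shift, chi] using hψ f hf
  · intro h t ht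
    rw [nhds_pi, Filter.mem_pi] at ht
    obtain ⟨I, hI, V, hV, hsub⟩ := ht
    obtain ⟨g, hg⟩ := h hI.toFinset
    refine ⟨_, hsub fun f hf => ?_, g, rfl⟩
    have h1 : A.shift (A.chi T) g f = A.chi Set.univ f := by
      simpa [shift, chi] using hg f (hI.mem_toFinset.2 hf)
    change A.shift (A.chi T) g f ∈ V f
    rw [h1]
    exact mem_of_mem_nhds (hV f)

theorem exists_common_factor {m : ℕ} (E : Finset (A.H m)) :
    ∃ N, ∀ f ∈ E, ∃ f' : A.sub m ↪[L] A.sub N, (A.sub N).subtype.comp f' = f := by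
  choose n f' _ hf using fun f : A.H m => exists_factor f
  refine ⟨E.sup n, fun f hfE => ⟨(A.incl (Finset.le_sup hfE)).comp (f' f), ?_⟩⟩
  conv_rhs => rw [← hf f]
  rfl

/-- Finitely many conditions `x ∘ f' ∈ T` hold together for some `x ∈ H N`, and `x` extends to an
automorphism. -/
theorem isThick_of_forall_mem_act (hK : L.IsUltrahomogeneous K) {m : ℕ} {T : Set (A.H m)}
    (α : A.Samuel) (h : ∀ f, T ∈ α.act f) : A.IsThick T := by
  refine isThick_iff.2 fun E => ?_
  obtain ⟨N, hN⟩ := exists_common_factor E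
  have hmem : (⋂ f ∈ E, {x : A.H N | ∃ f' : A.sub m ↪[L] A.sub N,
      (A.sub N).subtype.comp f' = f ∧ x.comp f' ∈ T}) ∈ α.coord N := by
    refine (Filter.biInter_finset_mem E).2 fun f hf => ?_
    obtain ⟨f', hf'⟩ := hN f hf
    filter_upwards [(α.mem_act f f' hf' T).1 (h f)] with x hx
    exact ⟨f', hf', hx⟩
  obtain ⟨x, hx⟩ := (α.coord N).nonempty_of_mem hmem
  simp only [Set.mem_iInter] at hx
  obtain ⟨g, rfl⟩ := exists_restrict_eq hK x
  refine ⟨g, fun f hf => ?_⟩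
  obtain ⟨f', rfl, hx⟩ := hx f hf
  exact hx

/-- Thickness makes the sets of `g` carrying a finite `E` into a given `T ∈ F` non-empty. They are
directed because `F` is closed under intersection, so an ultrafilter on `G` contains them all. -/
theorem exists_forall_mem_act {m : ℕ} {F : Filter (A.H m)}
    (hF : IsFamilyFilter (A.thickFamily m) F) :
    ∃ α : A.Samuel, ∀ f, ∀ T ∈ F, T ∈ α.act f := by
  classical
  let B : Filter (K ≃[L] K) := ⨅ i : {T // T ∈ F} × Finset (A.H m),
    𝓟 {g : K ≃[L] K | ∀ f ∈ i.2, g.toEmbedding.comp f ∈ i.1.1}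
  have hB : B.NeBot := by
    have : Nonempty {T // T ∈ F} := ⟨⟨Set.univ, univ_mem⟩⟩
    refine iInf_neBot_of_directed' ?_ ?_
    · intro i j
      refine ⟨(⟨i.1.1 ∩ j.1.1, inter_mem i.1.2 j.1.2⟩, i.2 ∪ j.2), ?_, ?_⟩ <;>
        refine principal_mono.2 fun g hg f hf => ?_
      · exact (hg f (Finset.mem_union_left _ hf)).1
      · exact (hg f (Finset.mem_union_right _ hf)).2
    · intro i
      exact principal_neBot_iff.2 (isThick_iff.1 (hF i.1.2) i.2)
  refine ⟨A.ofUltrafilter (Ultrafilter.of B), fun f T hT => ?_⟩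
  rw [mem_act_ofUltrafilter]
  refine Ultrafilter.of_le B (mem_iInf_of_mem (⟨T, hT⟩, {f}) (mem_principal.2 fun g hg => ?_))
  exact hg f (Finset.mem_singleton_self f)

theorem Samuel.mem_coord_mul_of_forall {α : A.Samuel} {m : ℕ} {T : Set (A.H m)}
    (h : ∀ f, T ∈ α.act f) (γ : A.Samuel) : T ∈ (α * γ).coord m :=
  (Samuel.mem_mul α γ m T).2 (Filter.univ_mem' h)

theorem Samuel.act_mem_coord_image (hK : L.IsUltrahomogeneous K) {I : Set A.Samuel}
    {α : A.Samuel} (h : ∀ γ, α * γ ∈ I) {m : ℕ} (f : A.H m) :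
    ∃ β ∈ I, β.coord m = α.act f := by
  obtain ⟨g, rfl⟩ := exists_restrict_eq hK f
  exact ⟨_, h _, α.coord_mul_pure g m⟩

theorem mem_of_forall_mem_clopenNhdsFilter {X : Type*} {Z : Set (Ultrafilter X)}
    (hZ : IsClosed Z) {p : Ultrafilter X} (h : ∀ T ∈ clopenNhdsFilter Z, T ∈ p) : p ∈ Z := by
  rw [(eq_iInter_clopenOf_iff hZ _).2 rfl]
  exact Set.mem_iInter₂.2 h

/-- If `α S(G)` projects into sets whose neighborhood filters are maximal among filters of thick
sets, then it is the whole inverse limit of these sets. -/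
theorem Samuel.mem_range_mul_of_maximal (hK : L.IsUltrahomogeneous K)
    {Yn : ∀ m, Set (Ultrafilter (A.H m))}
    (hmax : ∀ m, clopenNhdsFilter (Yn m) ∈ familyBeta (A.thickFamily m))
    {α : A.Samuel} (hα : ∀ γ m, (α * γ).coord m ∈ Yn m)
    {y : A.Samuel} (hy : ∀ m, y.coord m ∈ Yn m) : y ∈ Set.range fun γ => α * γ := by
  have hc : IsCompact (Set.range fun γ => α * γ) := isCompact_range α.continuous_mul_left
  refine Samuel.mem_of_coord hc y fun m => ?_
  set Z : Set (Ultrafilter (A.H m)) := (fun β : A.Samuel => β.coord m) '' Set.range fun γ => α * γ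
    with hZdef
  have hZ : IsClosed Z := (hc.image (Samuel.continuous_coord m)).isClosed
  have hZY : Z ⊆ Yn m := by
    rintro _ ⟨_, ⟨γ, rfl⟩, rfl⟩
    exact hα γ m
  have hthick : IsFamilyFilter (A.thickFamily m) (clopenNhdsFilter Z) := by
    intro T hT
    refine isThick_of_forall_mem_act hK α fun f => show α.act f ∈ clopenOf T from hT ?_
    obtain ⟨β, hβ, h⟩ := Samuel.act_mem_coord_image hK (fun γ => Set.mem_range_self γ) f
    exact ⟨β, hβ, h⟩
  have hle := (hmax m).2 _ hthick fun T hT => hZY.trans hT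
  exact mem_of_forall_mem_clopenNhdsFilter hZ fun T hT => hle hT (hy m)

theorem Samuel.isMinimalRightIdeal_of_maximal (hK : L.IsUltrahomogeneous K)
    {Yn : ∀ m, Set (Ultrafilter (A.H m))} (hclosed : ∀ m, IsClosed (Yn m))
    (hsurj : ∀ (m n : ℕ) (h : m ≤ n), A.dualBeta (A.incl h) '' Yn n = Yn m)
    (hmax : ∀ m, clopenNhdsFilter (Yn m) ∈ familyBeta (A.thickFamily m)) :
    IsMinimalRightIdeal {α : A.Samuel | ∀ m, α.coord m ∈ Yn m} := by
  have hact : ∀ m, ∃ α : A.Samuel, ∀ f : A.H m, α.act f ∈ Yn m := fun m => by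
    obtain ⟨α, hα⟩ := exists_forall_mem_act (hmax m).1
    exact ⟨α, fun f => mem_of_forall_mem_clopenNhdsFilter (hclosed m) (hα f)⟩
  -- A single `α` whose whole right ideal lies over every `Yn m`.
  obtain ⟨α, hα⟩ : ∃ α : A.Samuel, ∀ γ m, (α * γ).coord m ∈ Yn m := by
    have hc : ∀ m, IsClosed {α : A.Samuel | ∀ f : A.H m, α.act f ∈ Yn m} := fun m => by
      simp only [Set.ofPred_forall]
      exact isClosed_iInter fun f => (hclosed m).preimage (Samuel.continuous_act f)
    obtain ⟨α, hα⟩ := IsCompact.nonempty_iInter_of_sequence_nonempty_isCompact_isClosed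
      (fun m => {α : A.Samuel | ∀ f : A.H m, α.act f ∈ Yn m})
      -- The sets decrease: `f` extends to `A (m + 1)` by ultrahomogeneity, and the action commutes
      -- with restriction.
      (fun m α hα f => by
        obtain ⟨g, rfl⟩ := exists_restrict_eq hK f
        rw [← hsurj m (m + 1) m.le_succ]
        exact ⟨_, hα (A.restrict (m + 1) g), (α.act_dual (A.incl m.le_succ) _).symm⟩)
      hact (hc 0).isCompact hc
    rw [Set.mem_iInter] at hα
    exact ⟨α, fun γ m => mem_of_forall_mem_clopenNhdsFilter (hclosed m) fun T hT =>
      Samuel.mem_coord_mul_of_forall (fun f => hT (hα m f)) γ⟩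
  have hmem : ∀ β ∈ {α : A.Samuel | ∀ m, α.coord m ∈ Yn m}, ∀ γ : A.Samuel,
      β * γ ∈ {α : A.Samuel | ∀ m, α.coord m ∈ Yn m} := by
    intro β hβ γ
    -- Since `β = αδ`, the product `βγ = α(δγ)` stays in `α S(G)`.
    obtain ⟨δ, rfl⟩ := Samuel.mem_range_mul_of_maximal hK hmax hα hβ
    intro m
    have := hα (δ * γ) m
    rwa [← mul_assoc] at this
  refine ⟨⟨⟨α * α, hα α⟩, hmem⟩, fun J hJ hJY => hJY.antisymm fun y hy => ?_⟩
  obtain ⟨β, hβ⟩ := hJ.1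
  obtain ⟨γ, rfl⟩ := Samuel.mem_range_mul_of_maximal hK hmax
    (fun γ => hmem β (hJY hβ) γ) hy
  exact hJ.2 β hβ γ

/-- An idempotent `e ∈ Y` exists by Ellis's lemma, used in the opposite semigroup because it is `γ ↦
αγ` that is continuous. By minimality `eY = Y`, and `e` fixes `eY`. -/
theorem exists_left_identity_of_isMinimalRightIdeal {Y : Set A.Samuel} (hY : IsCompact Y)
    (hmin : IsMinimalRightIdeal Y) : ∃ u ∈ Y, ∀ y ∈ Y, u * y = y := by
  obtain ⟨u, hu, huu⟩ := exists_idempotent_in_compact_subsemigroup (M := A.Samuelᵐᵒᵖ)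
    (fun r => MulOpposite.continuous_op.comp
      (r.unop.continuous_mul_left.comp MulOpposite.continuous_unop))
    (MulOpposite.op '' Y) (hmin.1.1.image _) (hY.image MulOpposite.continuous_op)
    (by
      rintro _ ⟨x, -, rfl⟩ _ ⟨y, hy, rfl⟩
      exact ⟨y * x, hmin.1.2 y hy x, rfl⟩)
  obtain ⟨e, he, rfl⟩ := hu
  have hee : e * e = e := MulOpposite.op_injective huu
  have hright : IsRightIdeal ((fun y => e * y) '' Y) := by
    refine ⟨hmin.1.1.image _, ?_⟩
    rintro _ ⟨y, hy, rfl⟩ s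
    exact ⟨y * s, hmin.1.2 y hy s, (mul_assoc e y s).symm⟩
  have heq := hmin.2 _ hright (by
    rintro _ ⟨y, -, rfl⟩
    exact hmin.1.2 e he y)
  refine ⟨e, he, fun y hy => ?_⟩
  rw [← heq] at hy
  obtain ⟨z, -, rfl⟩ := hy
  change e * (e * z) = e * z
  rw [← mul_assoc, hee]

theorem Samuel.maximal_of_isMinimalRightIdeal (hK : L.IsUltrahomogeneous K)
    {Y : Set A.Samuel} (hY : IsCompact Y) (hmin : IsMinimalRightIdeal Y) (m : ℕ) :
    clopenNhdsFilter ((fun α : A.Samuel => α.coord m) '' Y) ∈ familyBeta (A.thickFamily m) := by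
  constructor
  · intro T hT
    obtain ⟨α, hα⟩ := hmin.1.1
    refine isThick_of_forall_mem_act hK α fun f => show α.act f ∈ clopenOf T from hT ?_
    obtain ⟨β, hβ, h⟩ := Samuel.act_mem_coord_image hK (hmin.1.2 α hα) f
    exact ⟨β, hβ, h⟩
  · intro F hF hle T hT
    obtain ⟨α, hα⟩ := exists_forall_mem_act hF
    obtain ⟨u, hu, hid⟩ := exists_left_identity_of_isMinimalRightIdeal hY hmin
    have hright : IsRightIdeal (Set.range fun γ => u * (α * γ)) := by
      refine ⟨⟨_, α, rfl⟩, ?_⟩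
      rintro _ ⟨γ, rfl⟩ s
      exact ⟨γ * s, by simp only [mul_assoc]⟩
    have heq := hmin.2 _ hright (by
      rintro _ ⟨γ, rfl⟩
      exact hmin.1.2 u hu _)
    rintro _ ⟨y, hy, rfl⟩
    rw [← heq] at hy
    obtain ⟨γ, rfl⟩ := hy
    -- The coordinate of `α * γ` is that of a member of `Y`, so `u` fixes it.
    have hclosed : IsClosed ((fun α : A.Samuel => α.coord m) '' Y) :=
      (hY.image (Samuel.continuous_coord m)).isClosed
    obtain ⟨z, hz, hzc⟩ := mem_of_forall_mem_clopenNhdsFilter hclosed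
      fun S hS => Samuel.mem_coord_mul_of_forall (fun f => hα f S (hle hS)) γ
    have hfix : (u * (α * γ)).coord m = (α * γ).coord m := by
      have hzc' : z.coord m = (α * γ).coord m := hzc
      rw [u.coord_mul, ← hzc', ← u.coord_mul, hid z hz]
    change T ∈ (u * (α * γ)).coord m
    rw [hfix]
    exact Samuel.mem_coord_mul_of_forall (fun f => hα f T hT) γ

end FiniteExhaustion

theorem mainTheorem1 {L : FirstOrder.Language.{u, v}} [L.IsRelational]
    {K : Type w} [L.Structure K] [Countable K] [Infinite K] (hK : L.IsUltrahomogeneous K)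
    (A : FiniteExhaustion L K)
    (Y : Set A.Samuel) (hY : IsCompact Y)
    (Yn : ∀ m, Set (Ultrafilter (A.H m))) (hclosed : ∀ m, IsClosed (Yn m))
    (hsurj : ∀ (m n : ℕ) (h : m ≤ n), A.dualBeta (A.incl h) '' Yn n = Yn m)
    (hlim : Y = {α : A.Samuel | ∀ m, α.coord m ∈ Yn m}) :
    IsMinimalRightIdeal Y ↔ ∀ m, clopenNhdsFilter (Yn m) ∈ familyBeta (A.thickFamily m) := by
  have himage : ∀ m, (fun α : A.Samuel => α.coord m) '' Y = Yn m := by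
    intro m
    subst hlim
    refine Set.Subset.antisymm ?_ fun p hp => ?_
    · rintro _ ⟨α, hα, rfl⟩
      exact hα m
    · obtain ⟨α, hα, h⟩ :=
        FiniteExhaustion.Samuel.exists_mem_limit_coord_eq hK hclosed hsurj hp
      exact ⟨α, hα, h⟩
  constructor
  · intro hmin m
    rw [← himage m]
    exact FiniteExhaustion.Samuel.maximal_of_isMinimalRightIdeal hK hY hmin m
  · intro hmax
    rw [hlim]
    exact FiniteExhaustion.Samuel.isMinimalRightIdeal_of_maximal hK hclosed hsurj hmax
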